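/- A probability distribution $G$ on $\mathbb{R}$ is called zero-symmetric if it is invariant under $x\mapsto -x$; let $\mathcal{S}$ be the set of all such distributions. A distribution is called symmetric if it is a translate of a zero-symmetric one. Let $$\Omega_3=\Bigl\{(\boldsymbol\lambda,\boldsymbol\mu)\in\mathbb{R}^3\times\mathbb{R}^3:\ \lambda_j\ge 0,\ \textstyle\sum_j\lambda_j=1,\ \mu_1<\mu_2<\mu_3\Bigr\},\qquad \Delta_3(\boldsymbol\lambda,\boldsymbol\mu)=\sum_{j=1}^3\lambda_j\delta_{\mu_j},$$ where $\delta_t$ is the point mass at $t$. A distribution $F$ is called $3$-identifiable if there is exactly one triple $(\boldsymbol\lambda,\boldsymbol\mu,G)\in\Omega_3\times\mathcal{S}$ with $F=G\star\Delta_3(\boldsymbol\lambda,\boldsymbol\mu)$, where $\star$ denotes convolution. Let $\Omega_3^*$ be the set of all $(\boldsymbol\lambda,\boldsymbol\mu)\in\Omega_3$ such that $G\star\Delta_3(\boldsymbol\lambda,\boldsymbol\mu)$ is $3$-identifiable for every $G\in\mathcal{S}$. **Theorem.** Let $A$ be the set of all $(\boldsymbol\lambda,\boldsymbol\mu)\in\Omega_3$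 that satisfy, for some real numbers $c,d,r$ with $d>0$ and $r>1$, at least one of the four conditions 1. $\boldsymbol\mu=(c,\,c+4d,\,c+6d)$ and $\boldsymbol\lambda\propto(r^2,\,r^2-1,\,r)$; 2. $\boldsymbol\mu=(c+d,\,c+3d,\,c+5d)$ and $\boldsymbol\lambda\propto(r,\,r+1,\,1)$; 3. $\boldsymbol\mu=(c,\,c+3d,\,c+4d)$ and $\boldsymbol\lambda\propto(r\sqrt r,\,(r-1)\sqrt{r+1},\,\sqrt r)$; 4. $\boldsymbol\mu=(c+d,\,c+2d,\,c+3d)$ and $\boldsymbol\lambda\propto(r,\,\sqrt{r+r^2},\,1)$. Let $A^-$ be the set of all $(\boldsymbol\lambda,\boldsymbol\mu)\in\Omega_3$ such that $((\lambda_3,\lambda_2,\lambda_1),(-\mu_3,-\mu_2,-\mu_1))\in A$, and let $B$ be the set of all $(\boldsymbol\lambda,\boldsymbol\mu)\in\Omega_3$ such that $\Delta_3(\boldsymbol\lambda,\boldsymbol\mu)$ is symmetric or $\lambda_1\lambda_2\lambda_3=0$. Then $$\Omega_3^*=\Omega_3\setminus(A\cup A^-\cup B).$$ -/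

import Mathlib

open MeasureTheory

noncomputable section

namespace SymMixture

/-- A parameter `θ = (weights, locations)` of a `k`-component location mixture. -/
abbrev Param (k : ℕ) : Type := (Fin k → ℝ) × (Fin k → ℝ)

/-- The parameter space `Ω_k`: nonnegative weights with sum `1`, increasing locations. -/
def Omega (k : ℕ) : Set (Param k) :=
  {θ | (∀ j, 0 ≤ θ.1 j) ∧ ∑ j, θ.1 j = 1 ∧ StrictMono θ.2}

/-- The `k`-point distribution `Δ_k(θ)`, with mass `θ.1 j` at the point `θ.2 j`. -/
def Delta {k : ℕ} (θ : Param k) : Measure ℝ :=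
  ∑ j, ENNReal.ofReal (θ.1 j) • Measure.dirac (θ.2 j)

/-- The set `𝒮` of all probability distributions on `ℝ` that are symmetric about zero. -/
def ZeroSymmetric : Set (Measure ℝ) :=
  {G | IsProbabilityMeasure G ∧ G.map (fun x => -x) = G}

/-- A distribution is symmetric if it is a translate of a zero-symmetric one. -/
def IsSymmetric (F : Measure ℝ) : Prop :=
  ∃ G ∈ ZeroSymmetric, ∃ s : ℝ, F = G.map (fun x => x + s)

/-- The map `φ_k` that sends `(θ, G)` to the mixture `G ⋆ Δ_k(θ)`. -/
def mixture {k : ℕ} (x : Param k × Measure ℝ) : Measure ℝ :=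
  x.2.conv (Delta x.1)

/-- The set `ℳ_k` of all `k`-component mixtures, the image of `φ_k` on `Ω_k × 𝒮`. -/
def Mixtures (k : ℕ) : Set (Measure ℝ) :=
  mixture '' (Omega k ×ˢ ZeroSymmetric)

/-- The inverse image of `F` under `φ_k : Ω_k × 𝒮 → ℳ_k`. -/
def fiber (k : ℕ) (F : Measure ℝ) : Set (Param k × Measure ℝ) :=
  {x | x ∈ Omega k ×ˢ ZeroSymmetric ∧ mixture x = F}

/-- `F` is `k`-identifiable: it is a `k`-component mixture in exactly one way. -/
def IsIdentifiable (k : ℕ) (F : Measure ℝ) : Prop :=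
  F ∈ Mixtures k ∧ ∃ x, fiber k F = {x}

/-- `Ω_k^*`: the parameters whose mixtures are `k`-identifiable for every `G ∈ 𝒮`. -/
def OmegaStar (k : ℕ) : Set (Param k) :=
  {θ | θ ∈ Omega k ∧ ∀ G ∈ ZeroSymmetric, IsIdentifiable k (G.conv (Delta θ))}

/-- `v ∝ w`, with a positive constant of proportionality. -/
def Proportional (v w : Fin 3 → ℝ) : Prop :=
  ∃ s : ℝ, 0 < s ∧ v = s • w

/-- Gaps in ratio `2 : 1`. -/
def CaseOne (c d r : ℝ) (θ : Param 3) : Prop :=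
  θ.2 = ![c, c + 4 * d, c + 6 * d] ∧ Proportional θ.1 ![r ^ 2, r ^ 2 - 1, r]

/-- The companion of `CaseOne`, with equal gaps. -/
def CaseOne' (c d r : ℝ) (θ : Param 3) : Prop :=
  θ.2 = ![c + d, c + 3 * d, c + 5 * d] ∧ Proportional θ.1 ![r, r + 1, 1]

/-- Gaps in ratio `3 : 1`. -/
def CaseTwo (c d r : ℝ) (θ : Param 3) : Prop :=
  θ.2 = ![c, c + 3 * d, c + 4 * d] ∧
    Proportional θ.1 ![r * √r, (r - 1) * √(r + 1), √r]

/-- The companion of `CaseTwo`, with equal gaps. -/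
def CaseTwo' (c d r : ℝ) (θ : Param 3) : Prop :=
  θ.2 = ![c + d, c + 2 * d, c + 3 * d] ∧ Proportional θ.1 ![r, √(r + r ^ 2), 1]

/-- The exceptional set `A`. -/
def setA : Set (Param 3) :=
  {θ | θ ∈ Omega 3 ∧ ∃ c d r : ℝ, 0 < d ∧ 1 < r ∧
    (CaseOne c d r θ ∨ CaseOne' c d r θ ∨ CaseTwo c d r θ ∨ CaseTwo' c d r θ)}

/-- The reflected set `A⁻`. -/
def setAneg : Set (Param 3) :=
  {θ | θ ∈ Omega 3 ∧
    ((![θ.1 2, θ.1 1, θ.1 0], ![-θ.2 2, -θ.2 1, -θ.2 0]) : Param 3) ∈ setA}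

/-- The set `B`: the three-point distribution is symmetric or some weight vanishes. -/
def setB : Set (Param 3) :=
  {θ | θ ∈ Omega 3 ∧ (IsSymmetric (Delta θ) ∨ θ.1 0 * θ.1 1 * θ.1 2 = 0)}

end SymMixture

end

open MeasureTheory

noncomputable section

namespace SymMixture

open scoped ComplexConjugate

/-! If two mixtures `G ⋆ Δ(θ)` and `G' ⋆ Δ(θ')` agree, the characteristic functions of `G` and `G'`
are real and that of `G` is nonzero near `0`, so the product of the transform of `Δ(θ)` with the
conjugate transform of `Δ(θ')` is real near `0`, hence everywhere by analyticity. Thus the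
difference of independent draws from the two point distributions is symmetric (`Compat`).
Conversely, compatible `θ ≠ θ'` give a mixture with two representations. Identifiability for all `G`
therefore becomes a finite question about pairs of three-point distributions (`mem_OmegaStar_iff`).

For such a pair, the extreme differences must balance, which forces a common midpoint of the end
locations and a common ratio `ρ` of the end weights (`ends_balanced`). After centring, only the six
differences in `Balanced` remain. Reflection gives `1 ≤ ρ` and exchange orders the half-widths.
Testing the balance at extreme points, where few atoms can cancel, leaves equality, symmetry or the
shapes in `Exceptional` (`Balanced.classification`). A second distribution with fewer than three
atoms is treated separately. Explicit companions show that every excluded parameter really fails. -/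

/-! ### Atomic measures and their characteristic functions -/

/-- The finite measure with mass `w j` at the point `x j`. -/
def atoms {ι : Type*} [Fintype ι] (w x : ι → ℝ) : Measure ℝ :=
  ∑ j, ENNReal.ofReal (w j) • Measure.dirac (x j)

instance isFiniteMeasure_atoms {ι : Type*} [Fintype ι] (w x : ι → ℝ) :
    IsFiniteMeasure (atoms w x) := by
  constructor
  simp [atoms, Measure.finsetSum_apply]

instance isFiniteMeasure_Delta {k : ℕ} (θ : Param k) : IsFiniteMeasure (Delta θ) :=
  isFiniteMeasure_atoms θ.1 θ.2

lemma atoms_real_singleton {ι : Type*} [Fintype ι] {w : ι → ℝ} (hw : ∀ j, 0 ≤ w j)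
    (x : ι → ℝ) (y : ℝ) :
    (atoms w x).real {y} = ∑ j, w j * (if x j = y then 1 else 0) := by
  rw [measureReal_def, atoms, Measure.finsetSum_apply, ENNReal.toReal_sum]
  · refine Finset.sum_congr rfl fun j _ => ?_
    rw [Measure.smul_apply, smul_eq_mul, ENNReal.toReal_mul, ENNReal.toReal_ofReal (hw j),
      Measure.dirac_apply' _ (measurableSet_singleton y)]
    by_cases h : x j = y <;> simp [h]
  · intro j _
    exact ENNReal.mul_ne_top ENNReal.ofReal_ne_top (measure_ne_top _ _)

lemma charFun_atoms {ι : Type*} [Fintype ι] {w : ι → ℝ} (hw : ∀ j, 0 ≤ w j)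
    (x : ι → ℝ) (t : ℝ) :
    charFun (atoms w x) t = ∑ j, (w j : ℂ) * Complex.exp (t * x j * Complex.I) := by
  rw [charFun_apply_real, atoms, integral_finsetSum_measure]
  · refine Finset.sum_congr rfl fun j _ => ?_
    rw [integral_smul_measure, integral_dirac, ENNReal.toReal_ofReal (hw j)]
    simp
  · intro j _
    exact (integrable_dirac (by simp)).smul_measure (by simp)

lemma charFun_Delta {k : ℕ} {θ : Param k} (hθ : θ ∈ Omega k) (t : ℝ) :
    charFun (Delta θ) t = ∑ j, (θ.1 j : ℂ) * Complex.exp (t * θ.2 j * Complex.I) :=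
  charFun_atoms hθ.1 θ.2 t

lemma isProbabilityMeasure_Delta {k : ℕ} {θ : Param k} (hθ : θ ∈ Omega k) :
    IsProbabilityMeasure (Delta θ) := by
  constructor
  rw [Delta, Measure.finsetSum_apply]
  simp only [Measure.smul_apply, measure_univ, smul_eq_mul, mul_one]
  rw [← ENNReal.ofReal_sum_of_nonneg fun j _ => hθ.1 j, hθ.2.1, ENNReal.ofReal_one]

lemma charFun_map_neg (μ : Measure ℝ) (t : ℝ) :
    charFun (μ.map (fun x => -x)) t = conj (charFun μ t) := by
  have := charFun_map_mul (μ := μ) (-1) t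
  simpa [charFun_neg] using this

lemma mem_zeroSymmetric_iff {G : Measure ℝ} :
    G ∈ ZeroSymmetric ↔ IsProbabilityMeasure G ∧ ∀ t, (charFun G t).im = 0 := by
  constructor
  · rintro ⟨hG, h⟩
    refine ⟨hG, fun t => ?_⟩
    rw [← Complex.conj_eq_iff_im, ← charFun_map_neg, h]
  · rintro ⟨hG, h⟩
    refine ⟨hG, Measure.ext_of_charFun (funext fun t => ?_)⟩
    rw [charFun_map_neg, Complex.conj_eq_iff_im, h]

/-! ### Compatibility of parameters -/

/-- Two parameters are compatible if the difference of independent draws from their point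
distributions is symmetric about zero, expressed through the imaginary part of its
characteristic function. -/
def Compat {k : ℕ} (θ θ' : Param k) : Prop :=
  ∀ t : ℝ, ∑ i, ∑ j, θ.1 i * θ'.1 j * Real.sin (t * (θ.2 i - θ'.2 j)) = 0

lemma im_charFun_Delta_mul_conj {k : ℕ} {θ θ' : Param k} (hθ : θ ∈ Omega k)
    (hθ' : θ' ∈ Omega k) (t : ℝ) :
    (charFun (Delta θ) t * conj (charFun (Delta θ') t)).im =
      ∑ i, ∑ j, θ.1 i * θ'.1 j * Real.sin (t * (θ.2 i - θ'.2 j)) := by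
  rw [charFun_Delta hθ, charFun_Delta hθ', map_sum, Finset.sum_mul_sum, Complex.im_sum]
  refine Finset.sum_congr rfl fun i _ => ?_
  rw [Complex.im_sum]
  refine Finset.sum_congr rfl fun j _ => ?_
  have : (θ.1 i : ℂ) * Complex.exp (t * θ.2 i * Complex.I) *
      conj ((θ'.1 j : ℂ) * Complex.exp (t * θ'.2 j * Complex.I)) =
      ((θ.1 i * θ'.1 j : ℝ) : ℂ) *
        Complex.exp ((t * (θ.2 i - θ'.2 j) : ℝ) * Complex.I) := by
    rw [map_mul, ← Complex.exp_conj, mul_mul_mul_comm, ← Complex.exp_add]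
    simp only [map_mul, Complex.conj_ofReal, Complex.conj_I, Complex.ofReal_mul,
      Complex.ofReal_sub]
    congr 2
    ring
  rw [this, Complex.im_ofReal_mul, Complex.exp_ofReal_mul_I_im]

lemma compat_iff {k : ℕ} {θ θ' : Param k} (hθ : θ ∈ Omega k) (hθ' : θ' ∈ Omega k) :
    Compat θ θ' ↔ ∀ t, (charFun (Delta θ) t * conj (charFun (Delta θ') t)).im = 0 := by
  simp only [im_charFun_Delta_mul_conj hθ hθ', Compat]

lemma Compat.symm {k : ℕ} {θ θ' : Param k} (h : Compat θ θ') : Compat θ' θ := by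
  intro t
  rw [Finset.sum_comm, ← neg_eq_zero, ← h t, ← Finset.sum_neg_distrib]
  refine Finset.sum_congr rfl fun i _ => ?_
  rw [← Finset.sum_neg_distrib]
  refine Finset.sum_congr rfl fun j _ => ?_
  rw [show t * (θ'.2 j - θ.2 i) = -(t * (θ.2 i - θ'.2 j)) by ring, Real.sin_neg]
  ring

lemma mul_conj_im_self (z : ℂ) : (z * conj z).im = 0 := by
  rw [Complex.mul_conj]; exact Complex.ofReal_im _

lemma compat_of_Delta_eq {k : ℕ} {θ θ' : Param k} (hθ : θ ∈ Omega k) (hθ' : θ' ∈ Omega k)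
    (h : Delta θ = Delta θ') : Compat θ θ' := by
  rw [compat_iff hθ hθ', h]
  exact fun t => mul_conj_im_self _

/-- Differences of compatible parameters carry the same mass at `x` and at `-x`. -/
lemma Compat.mass_eq {k : ℕ} {θ θ' : Param k} (hθ : θ ∈ Omega k) (hθ' : θ' ∈ Omega k)
    (h : Compat θ θ') (x : ℝ) :
    ∑ i, ∑ j, θ.1 i * θ'.1 j * (if θ.2 i - θ'.2 j = x then 1 else 0) =
      ∑ i, ∑ j, θ.1 i * θ'.1 j * (if θ.2 i - θ'.2 j = -x then 1 else 0) := by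
  let w : Fin k × Fin k → ℝ := fun p => θ.1 p.1 * θ'.1 p.2
  let y : Fin k × Fin k → ℝ := fun p => θ.2 p.1 - θ'.2 p.2
  have hw : ∀ p, 0 ≤ w p := fun p => mul_nonneg (hθ.1 _) (hθ'.1 _)
  have key : (atoms w y).map (fun x => -x) = atoms w y := by
    refine Measure.ext_of_charFun (funext fun t => ?_)
    rw [charFun_map_neg, Complex.conj_eq_iff_im, charFun_atoms hw, Fintype.sum_prod_type,
      ← h t, Complex.im_sum]
    refine Finset.sum_congr rfl fun i _ => ?_
    rw [Complex.im_sum]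
    refine Finset.sum_congr rfl fun j _ => ?_
    rw [Complex.im_ofReal_mul, ← Complex.ofReal_mul, Complex.exp_ofReal_mul_I_im]
  have h1 := atoms_real_singleton hw y x
  have h2 := atoms_real_singleton hw y (-x)
  rw [Fintype.sum_prod_type] at h1 h2
  rw [← h1, ← h2, measureReal_def, measureReal_def]
  conv_lhs => rw [← key]
  rw [Measure.map_apply measurable_neg (measurableSet_singleton x)]
  congr 2
  ext z
  simp

/-! ### Reduction of identifiability to compatibility -/

lemma charFun_Delta_analyticOnNhd {k : ℕ} {θ : Param k} (hθ : θ ∈ Omega k) :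
    AnalyticOnNhd ℝ (charFun (Delta θ)) Set.univ := by
  intro t _
  have : charFun (Delta θ) =
      fun t : ℝ => ∑ j, (θ.1 j : ℂ) * Complex.exp (t * θ.2 j * Complex.I) :=
    funext fun t => charFun_Delta hθ t
  rw [this]
  refine Finset.analyticAt_fun_sum _ fun j _ => ?_
  have h1 : AnalyticAt ℝ (fun t : ℝ => (t : ℂ)) t := Complex.ofRealCLM.analyticAt t
  have h2 : AnalyticAt ℝ Complex.exp (t * θ.2 j * Complex.I) :=
    analyticAt_cexp.restrictScalars
  exact analyticAt_const.mul
    (h2.comp_of_eq ((h1.mul analyticAt_const).mul analyticAt_const) rfl)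

lemma compat_of_conv_eq {k : ℕ} {θ θ' : Param k} (hθ : θ ∈ Omega k) (hθ' : θ' ∈ Omega k)
    {G G' : Measure ℝ} (hG : G ∈ ZeroSymmetric) (hG' : G' ∈ ZeroSymmetric)
    (h : G.conv (Delta θ) = G'.conv (Delta θ')) : Compat θ θ' := by
  obtain ⟨hG1, hG2⟩ := mem_zeroSymmetric_iff.1 hG
  obtain ⟨hG1', hG2'⟩ := mem_zeroSymmetric_iff.1 hG'
  have hprod : ∀ t, charFun G t * charFun (Delta θ) t = charFun G' t * charFun (Delta θ') t := by
    intro t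
    rw [← charFun_conv, ← charFun_conv, h]
  have hnear : ∀ᶠ t in nhds (0 : ℝ), charFun G t ≠ 0 := by
    refine (continuous_charFun (μ := G)).continuousAt.eventually_ne ?_
    simp
  have hzero : ∀ᶠ t in nhds (0 : ℝ),
      ∑ i, ∑ j, θ.1 i * θ'.1 j * Real.sin (t * (θ.2 i - θ'.2 j)) = 0 := by
    filter_upwards [hnear] with t ht
    rw [← im_charFun_Delta_mul_conj hθ hθ']
    have e1 : charFun G t = ((charFun G t).re : ℂ) :=
      (Complex.conj_eq_iff_real.1 (Complex.conj_eq_iff_im.2 (hG2 t))).elim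
        fun r hr => by rw [hr, Complex.ofReal_re]
    have e2 : charFun G' t = ((charFun G' t).re : ℂ) :=
      (Complex.conj_eq_iff_real.1 (Complex.conj_eq_iff_im.2 (hG2' t))).elim
        fun r hr => by rw [hr, Complex.ofReal_re]
    -- The product equals the transform of `G'` times a squared modulus, so it is real; dividing by
    -- the real nonzero transform of `G` leaves a real number.
    have e3 : (charFun G t * (charFun (Delta θ) t * conj (charFun (Delta θ') t))).im = 0 := by
      rw [← mul_assoc, hprod, mul_assoc, e2, Complex.im_ofReal_mul, mul_conj_im_self, mul_zero]
    rw [e1, Complex.im_ofReal_mul] at e3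
    refine (mul_eq_zero.1 e3).resolve_left fun h0 => ht ?_
    rw [e1, h0, Complex.ofReal_zero]
  have han : AnalyticOnNhd ℝ (fun t : ℝ =>
      ∑ i, ∑ j, θ.1 i * θ'.1 j * Real.sin (t * (θ.2 i - θ'.2 j))) Set.univ := by
    intro t _
    refine Finset.analyticAt_fun_sum _ fun i _ => Finset.analyticAt_fun_sum _ fun j _ => ?_
    exact analyticAt_const.mul
      (Real.analyticAt_sin.comp (analyticAt_id.mul analyticAt_const))
  intro t
  exact han.eqOn_zero_of_preconnected_of_eventuallyEq_zero isPreconnected_univ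
    (Set.mem_univ 0) hzero (Set.mem_univ t)

/-- Where the transforms of `G` and `G'` differ, an open set, the transform of `Δ(θ)` would vanish;
being analytic with value `1` at `0`, it cannot. So the symmetric factor is determined by `θ`. -/
lemma eq_of_conv_Delta_eq {k : ℕ} {θ : Param k} (hθ : θ ∈ Omega k) {G G' : Measure ℝ}
    (hG : IsProbabilityMeasure G) (hG' : IsProbabilityMeasure G')
    (h : G.conv (Delta θ) = G'.conv (Delta θ)) : G = G' := by
  refine Measure.ext_of_charFun (funext fun t => ?_)
  by_contra hne
  have hprod : ∀ t, charFun G t * charFun (Delta θ) t = charFun G' t * charFun (Delta θ) t := by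
    intro t
    rw [← charFun_conv, ← charFun_conv, h]
  have hnear : ∀ᶠ s in nhds t, charFun (Delta θ) s = 0 := by
    have hev : ∀ᶠ s in nhds t, charFun G s ≠ charFun G' s :=
      (continuous_charFun (μ := G)).continuousAt.ne_iff_eventually_ne
        (continuous_charFun (μ := G')).continuousAt |>.1 hne
    filter_upwards [hev] with s hs
    by_contra h0
    exact hs (mul_right_cancel₀ h0 (hprod s))
  have := (charFun_Delta_analyticOnNhd hθ).eqOn_zero_of_preconnected_of_eventuallyEq_zero
    isPreconnected_univ (Set.mem_univ t) hnear (Set.mem_univ 0)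
  have := isProbabilityMeasure_Delta hθ
  simp_all

lemma mem_zeroSymmetric_conv_neg {k : ℕ} {θ θ' : Param k} (hθ : θ ∈ Omega k)
    (hθ' : θ' ∈ Omega k) (h : Compat θ θ') :
    (Delta θ).conv ((Delta θ').map (fun x => -x)) ∈ ZeroSymmetric := by
  have := isProbabilityMeasure_Delta hθ
  have := isProbabilityMeasure_Delta hθ'
  have : IsProbabilityMeasure ((Delta θ').map (fun x => -x)) :=
    Measure.isProbabilityMeasure_map measurable_neg.aemeasurable
  refine mem_zeroSymmetric_iff.2 ⟨inferInstance, fun t => ?_⟩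
  rw [charFun_conv, charFun_map_neg]
  exact (compat_iff hθ hθ').1 h t

/-- A parameter lies in `Ω_k^*` iff it is compatible with no other parameter. -/
lemma mem_OmegaStar_iff {k : ℕ} {θ : Param k} :
    θ ∈ OmegaStar k ↔ θ ∈ Omega k ∧ ∀ θ' ∈ Omega k, Compat θ θ' → θ' = θ := by
  constructor
  · rintro ⟨hθ, h⟩
    refine ⟨hθ, fun θ' hθ' hc => ?_⟩
    -- Let `R` be the reflection of `Δ(θ')`. Then `(Δ(θ') ⋆ R) ⋆ Δ(θ) = (Δ(θ) ⋆ R) ⋆ Δ(θ')`, and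
    -- both bracketed measures are zero-symmetric.
    obtain ⟨-, x, hx⟩ := h _ (mem_zeroSymmetric_conv_neg hθ' hθ'
      (compat_of_Delta_eq hθ' hθ' rfl))
    have h1 : (θ, (Delta θ').conv ((Delta θ').map (fun x => -x))) ∈ ({x} : Set _) :=
      hx ▸ ⟨⟨hθ, mem_zeroSymmetric_conv_neg hθ' hθ' (compat_of_Delta_eq hθ' hθ' rfl)⟩, rfl⟩
    have h2 : (θ', (Delta θ).conv ((Delta θ').map (fun x => -x))) ∈ ({x} : Set _) := by
      refine hx ▸ ⟨⟨hθ', mem_zeroSymmetric_conv_neg hθ hθ' hc⟩, ?_⟩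
      simp only [mixture]
      refine Measure.ext_of_charFun (funext fun t => ?_)
      simp only [charFun_conv]
      ring
    exact congrArg Prod.fst (h2.trans h1.symm)
  · rintro ⟨hθ, h⟩
    refine ⟨hθ, fun G hG => ⟨⟨(θ, G), ⟨hθ, hG⟩, rfl⟩, (θ, G), ?_⟩⟩
    ext ⟨θ', G'⟩
    constructor
    · rintro ⟨⟨hθ', hG'⟩, he⟩
      have he' : G'.conv (Delta θ') = G.conv (Delta θ) := he
      obtain rfl : θ' = θ := h θ' hθ' (compat_of_conv_eq hθ hθ' hG hG' he'.symm)
      exact congrArg (Prod.mk θ') (eq_of_conv_Delta_eq hθ hG'.1 hG.1 he')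
    · intro hx
      rw [Set.mem_singleton_iff] at hx
      rw [hx]
      exact ⟨⟨hθ, hG⟩, rfl⟩

/-! ### Odd masses and the balance equation -/

/-- The signed mass at `x` of the odd measure `δ_y - δ_{-y}`. -/
def oddInd (y x : ℝ) : ℝ := (if y = x then 1 else 0) - (if y = -x then 1 else 0)

lemma oddInd_self {y : ℝ} (hy : y ≠ 0) : oddInd y y = 1 := by
  have : y ≠ -y := fun h => hy (by linarith)
  simp [oddInd, this]

lemma oddInd_neg (y x : ℝ) : oddInd (-y) x = -oddInd y x := by
  simp only [oddInd, neg_eq_iff_eq_neg, neg_neg]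
  ring

lemma oddInd_zero (x : ℝ) : oddInd 0 x = 0 := by
  have h := oddInd_neg 0 x
  rw [neg_zero] at h
  linarith

/-- Together with `oddInd_nonpos`, this allows sign arguments at a test point without deciding which
atoms coincide there. -/
lemma oddInd_nonneg {y x : ℝ} (h : y ≠ -x) : 0 ≤ oddInd y x := by
  unfold oddInd
  rw [if_neg h]
  split_ifs <;> norm_num

lemma oddInd_nonpos {y x : ℝ} (h : y ≠ x) : oddInd y x ≤ 0 := by
  unfold oddInd
  rw [if_neg h]
  split_ifs <;> norm_num

lemma oddInd_eq_zero {y x : ℝ} (h : y ≠ x) (h' : y ≠ -x) : oddInd y x = 0 :=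
  le_antisymm (oddInd_nonpos h) (oddInd_nonneg h')

/-- The odd part of the difference distribution of the three-point distributions with weights
`(ρ, p, 1)` at `(-A, m, A)` and `(ρ, q, 1)` at `(-B, n, B)` vanishes. -/
def Balanced (A B m n ρ p q : ℝ) : Prop :=
  ∀ x, (1 - ρ ^ 2) * oddInd (A - B) x + q * oddInd (A - n) x - q * ρ * oddInd (A + n) x
    - p * oddInd (B - m) x + p * ρ * oddInd (B + m) x + p * q * oddInd (m - n) x = 0

lemma Balanced.swap {A B m n ρ p q : ℝ} (h : Balanced A B m n ρ p q) :
    Balanced B A n m ρ q p := by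
  intro x
  have h1 := oddInd_neg (A - B) x
  have h2 := oddInd_neg (m - n) x
  rw [neg_sub] at h1 h2
  rw [h1, h2]
  linarith [h x]

/-- Reflection reverses each weight vector; dividing by `ρ` makes its last entry `1` again. This is
what permits the assumption `1 ≤ ρ`. -/
lemma Balanced.reflect {A B m n ρ p q : ℝ} (hρ : 0 < ρ) (h : Balanced A B m n ρ p q) :
    Balanced A B (-m) (-n) ρ⁻¹ (p * ρ⁻¹) (q * ρ⁻¹) := by
  intro x
  have h2 := oddInd_neg (m - n) x
  have e1 : A - -n = A + n := by ring
  have e2 : A + -n = A - n := by ring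
  have e3 : B - -m = B + m := by ring
  have e4 : B + -m = B - m := by ring
  have e5 : -m - -n = -(m - n) := by ring
  rw [e1, e2, e3, e4, e5, h2]
  have := h x
  field_simp
  linarith

/-! ### Classification of balanced pairs -/

lemma Balanced.of_lt {A B m n ρ p q : ℝ} (h : Balanced A B m n ρ p q) (hB : 0 < B)
    (hAB : B < A) (hmA : m < A) (hAm : -A < m) (hnB : n < B) (hBn : -B < n)
    (hρ : 1 < ρ) (hp : 0 < p) (hq : 0 < q) :
    n = 0 ∧ m = A - B ∧ q * (ρ - 1) = p * ρ ∧
      ((A = 2 * B ∧ p * q = ρ ^ 2 - 1) ∨ (2 * A = 3 * B ∧ p * (q - 1) = ρ ^ 2 - 1)) := by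
  have hρ2 : 0 < ρ ^ 2 - 1 := by nlinarith
  have hpq : 0 < p * q := mul_pos hp hq
  have hpρ : 0 < p * ρ := by positivity
  have hqρ : 0 < q * ρ := by positivity
  have hn : n = 0 := by
    by_contra hn
    -- If `n ≤ m`, the atom at `A - n` has coefficient `q > 0` and nothing negative can meet it.
    have hmn : m < n := by
      by_contra! hmn
      have hx := h (A - n)
      have e1 : oddInd (A - B) (A - n) = 0 :=
        oddInd_eq_zero (fun h => by linarith) (fun h => by linarith)
      have e2 : oddInd (A - n) (A - n) = 1 := oddInd_self (fun h => by linarith)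
      have e3 : oddInd (A + n) (A - n) = 0 :=
        oddInd_eq_zero (fun h => hn (by linarith)) (fun h => by linarith)
      have e4 : oddInd (B - m) (A - n) = 0 :=
        oddInd_eq_zero (fun h => by linarith) (fun h => by linarith)
      have e5 : 0 ≤ oddInd (B + m) (A - n) := oddInd_nonneg (fun h => by linarith)
      have e6 : 0 ≤ oddInd (m - n) (A - n) := oddInd_nonneg (fun h => by linarith)
      rw [e1, e2, e3, e4] at hx
      linarith [mul_nonneg hpρ.le e5, mul_nonneg hpq.le e6]
    -- Now the atom at `A + n` has coefficient `-qρ`, and no other term contributes positively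
    -- there.
    have hx := h (A + n)
    have e1 : 0 ≤ oddInd (A - B) (A + n) := oddInd_nonneg (fun h => by linarith)
    have e2 : oddInd (A - n) (A + n) = 0 :=
      oddInd_eq_zero (fun h => hn (by linarith)) (fun h => by linarith)
    have e3 : oddInd (A + n) (A + n) = 1 := oddInd_self (fun h => by linarith)
    have e4 : 0 ≤ oddInd (B - m) (A + n) := oddInd_nonneg (fun h => by linarith)
    have e5 : oddInd (B + m) (A + n) ≤ 0 := oddInd_nonpos (fun h => by linarith)
    have e6 : oddInd (m - n) (A + n) ≤ 0 := oddInd_nonpos (fun h => by linarith)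
    rw [e2, e3] at hx
    linarith [mul_nonneg hρ2.le e1, mul_nonneg hp.le e4,
      mul_nonneg hpρ.le (neg_nonneg.2 e5), mul_nonneg hpq.le (neg_nonneg.2 e6)]
  subst hn
  simp only [Balanced, sub_zero, add_zero] at h
  have hx := h A
  have e2 : oddInd A A = 1 := oddInd_self (fun h => by linarith)
  rw [e2] at hx
  -- With `n = 0`, the net mass `q (1 - ρ)` at `A` is negative; only the atom at `B + m` can offset
  -- it.
  have hm : m = A - B := by
    by_contra hm
    have e1 : 0 ≤ oddInd (A - B) A := oddInd_nonneg (fun h => by linarith)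
    have e4 : 0 ≤ oddInd (B - m) A := oddInd_nonneg (fun h => by linarith)
    have e5 : oddInd (B + m) A ≤ 0 := oddInd_nonpos (fun h => hm (by linarith))
    have e6 : oddInd m A ≤ 0 := oddInd_nonpos (fun h => by linarith)
    nlinarith [mul_nonneg hρ2.le e1, mul_nonneg hp.le e4, mul_pos hq (sub_pos.2 hρ),
      mul_nonneg hpρ.le (neg_nonneg.2 e5), mul_nonneg hpq.le (neg_nonneg.2 e6)]
  subst hm
  have s1 : B - (A - B) = 2 * B - A := by ring
  have s2 : B + (A - B) = A := by ring
  rw [s1, s2] at h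
  refine ⟨rfl, rfl, ?_, ?_⟩
  · have e1 : oddInd (A - B) A = 0 :=
      oddInd_eq_zero (fun h => by linarith) (fun h => by linarith)
    have e4 : oddInd (2 * B - A) A = 0 :=
      oddInd_eq_zero (fun h => by linarith) (fun h => by linarith)
    rw [s1, s2, e1, e2, e4] at hx
    linarith
  -- The atoms left are at `A - B` and `2B - A`. The latter must be at zero (`A = 2B`) or merge with
  -- the former (`2A = 3B`); otherwise it stands alone with coefficient `-p`.
  have hy := h (A - B)
  have e1 : oddInd (A - B) (A - B) = 1 := oddInd_self (fun h => by linarith)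
  have e2 : oddInd A (A - B) = 0 :=
    oddInd_eq_zero (fun h => by linarith) (fun h => by linarith)
  rw [e1, e2] at hy
  by_cases h2 : A = 2 * B
  · left
    rw [show 2 * B - A = 0 by linarith, oddInd_zero] at hy
    exact ⟨h2, by linarith⟩
  right
  by_cases h3 : 2 * A = 3 * B
  · rw [show 2 * B - A = A - B by linarith, e1] at hy
    exact ⟨h3, by linarith⟩
  exfalso
  have hz := h (2 * B - A)
  have f1 : oddInd (A - B) (2 * B - A) = 0 :=
    oddInd_eq_zero (fun h => h3 (by linarith)) (fun h => by linarith)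
  have f2 : oddInd A (2 * B - A) = 0 :=
    oddInd_eq_zero (fun h => by linarith) (fun h => by linarith)
  have f3 : oddInd (2 * B - A) (2 * B - A) = 1 := oddInd_self (fun h => h2 (by linarith))
  rw [f1, f2, f3] at hz
  linarith

/-- If `n < m`, an atom of positive coefficient stays unopposed: at `A - n` when `m = 0`, at `A + m`
otherwise. -/
lemma Balanced.not_lt_of_eq {A m n ρ p q : ℝ} (h : Balanced A A m n ρ p q)
    (hmA : m < A) (hAm : -A < m) (hAn : -A < n)
    (hρ : 0 < ρ) (hp : 0 < p) (hq : 0 < q) : ¬ n < m := by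
  intro hnm
  have hA : 0 < A := by linarith
  have hpq : 0 < p * q := mul_pos hp hq
  have hpρ : 0 < p * ρ := by positivity
  simp only [Balanced, sub_self, oddInd_zero, mul_zero, zero_add] at h
  by_cases hm : m = 0
  · subst hm
    have hx := h (A - n)
    have e2 : oddInd (A - n) (A - n) = 1 := oddInd_self (fun h => by linarith)
    have e3 : oddInd (A + n) (A - n) = 0 :=
      oddInd_eq_zero (fun h => by linarith) (fun h => by linarith)
    have e4 : oddInd (A - 0) (A - n) = 0 :=
      oddInd_eq_zero (fun h => by linarith) (fun h => by linarith)
    have e5 : oddInd (A + 0) (A - n) = 0 :=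
      oddInd_eq_zero (fun h => by linarith) (fun h => by linarith)
    have e6 : 0 ≤ oddInd (0 - n) (A - n) := oddInd_nonneg (fun h => by linarith)
    rw [e2, e3, e4, e5] at hx
    linarith [mul_nonneg hpq.le e6]
  · have hx := h (A + m)
    have e2 : 0 ≤ oddInd (A - n) (A + m) := oddInd_nonneg (fun h => by linarith)
    have e3 : oddInd (A + n) (A + m) = 0 :=
      oddInd_eq_zero (fun h => by linarith) (fun h => by linarith)
    have e4 : oddInd (A - m) (A + m) = 0 :=
      oddInd_eq_zero (fun h => hm (by linarith)) (fun h => by linarith)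
    have e5 : oddInd (A + m) (A + m) = 1 := oddInd_self (fun h => by linarith)
    have e6 : 0 ≤ oddInd (m - n) (A + m) := oddInd_nonneg (fun h => by linarith)
    rw [e3, e4, e5] at hx
    linarith [mul_nonneg hpq.le e6, mul_nonneg hq.le e2]

lemma Balanced.of_eq {A m n ρ p q : ℝ} (h : Balanced A A m n ρ p q)
    (hmA : m < A) (hAm : -A < m) (hnA : n < A) (hAn : -A < n)
    (hρ : 0 < ρ) (hp : 0 < p) (hq : 0 < q) :
    (m = 0 ∧ ρ = 1) ∨ (m = n ∧ p = q) := by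
  obtain rfl : m = n := le_antisymm
    (not_lt.1 (h.not_lt_of_eq hmA hAm hAn hρ hp hq))
    (not_lt.1 (h.swap.not_lt_of_eq hnA hAn hAm hρ hq hp))
  have hx := h (A + m)
  have e5 : oddInd (A + m) (A + m) = 1 := oddInd_self (fun h => by linarith)
  rw [sub_self, oddInd_zero, sub_self, oddInd_zero, e5] at hx
  by_cases hm : m = 0
  · subst hm
    rw [add_zero] at e5
    rw [sub_zero, add_zero, e5] at hx
    have : (q - p) * (1 - ρ) = 0 := by linarith
    rcases mul_eq_zero.1 this with h | h
    · exact .inr ⟨rfl, by linarith⟩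
    · exact .inl ⟨rfl, by linarith⟩
  · have e4 : oddInd (A - m) (A + m) = 0 :=
      oddInd_eq_zero (fun h => hm (by linarith)) (fun h => by linarith)
    rw [e4] at hx
    have : (p - q) * ρ = 0 := by linarith
    rcases mul_eq_zero.1 this with h | h
    · exact .inr ⟨rfl, by linarith⟩
    · exact absurd h hρ.ne'

/-- For `n > 0` the cancellations chain: the atom at `A + n` forces `B + m = A + n`, then the one at
`m - n` forces `B - m = m - n`, and the atom at `A - n` is left unmatched. -/
lemma Balanced.not_pos_of_lt_of_one {A B m n p q : ℝ} (h : Balanced A B m n 1 p q)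
    (hAB : B < A) (hmA : m < A) (hnB : n < B)
    (hp : 0 < p) (hq : 0 < q) : ¬ 0 < n := by
  intro hn
  have hpq : 0 < p * q := mul_pos hp hq
  have hx := h (A + n)
  have e2 : oddInd (A - n) (A + n) = 0 :=
    oddInd_eq_zero (fun h => by linarith) (fun h => by linarith)
  have e3 : oddInd (A + n) (A + n) = 1 := oddInd_self (fun h => by linarith)
  have e4 : 0 ≤ oddInd (B - m) (A + n) := oddInd_nonneg (fun h => by linarith)
  have e6 : oddInd (m - n) (A + n) ≤ 0 := oddInd_nonpos (fun h => by linarith)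
  rw [e2, e3] at hx
  have hm : B + m = A + n := by
    by_contra hm
    have e5 : oddInd (B + m) (A + n) ≤ 0 := oddInd_nonpos hm
    linarith [mul_nonneg hp.le e4, mul_nonneg hp.le (neg_nonneg.2 e5),
      mul_nonneg hpq.le (neg_nonneg.2 e6)]
  have hy := h (m - n)
  have f2 : 0 ≤ oddInd (A - n) (m - n) := oddInd_nonneg (fun h => by linarith)
  have f3 : oddInd (A + n) (m - n) = 0 :=
    oddInd_eq_zero (fun h => by linarith) (fun h => by linarith)
  have f5 : oddInd (B + m) (m - n) = 0 := by rw [hm, f3]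
  have f6 : oddInd (m - n) (m - n) = 1 := oddInd_self (fun h => by linarith)
  rw [f3, f5, f6] at hy
  have hm2 : B - m = m - n := by
    by_contra hne
    have f4 : oddInd (B - m) (m - n) ≤ 0 := oddInd_nonpos hne
    linarith [mul_nonneg hq.le f2, mul_nonneg hp.le (neg_nonneg.2 f4)]
  have hz := h (A - n)
  have g2 : oddInd (A - n) (A - n) = 1 := oddInd_self (fun h => by linarith)
  have g3 : oddInd (A + n) (A - n) = 0 :=
    oddInd_eq_zero (fun h => by linarith) (fun h => by linarith)
  have g5 : oddInd (B + m) (A - n) = 0 := by rw [hm, g3]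
  have g6 : oddInd (m - n) (A - n) = 0 :=
    oddInd_eq_zero (fun h => by linarith) (fun h => by linarith)
  have g4 : oddInd (B - m) (A - n) = 0 := by rw [hm2, g6]
  rw [g2, g3, g4, g5, g6] at hz
  linarith

lemma Balanced.of_lt_of_one {A B m n p q : ℝ} (h : Balanced A B m n 1 p q)
    (hAB : B < A) (hmA : m < A) (hAm : -A < m) (hnB : n < B) (hBn : -B < n)
    (hp : 0 < p) (hq : 0 < q) : m = 0 ∧ n = 0 := by
  have hr := h.reflect one_pos
  rw [inv_one, mul_one, mul_one] at hr
  have h1 := h.not_pos_of_lt_of_one hAB hmA hnB hp hq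
  have h2 := hr.not_pos_of_lt_of_one hAB (by linarith) (by linarith) hp hq
  obtain rfl : n = 0 := by linarith
  refine ⟨?_, rfl⟩
  have key : ∀ k, Balanced A B k 0 1 p q → k ≤ 0 := by
    intro k hk
    by_contra! hk0
    have hx := hk (B + k)
    rw [sub_zero, add_zero, sub_zero] at hx
    have e4 : oddInd (B - k) (B + k) = 0 :=
      oddInd_eq_zero (fun h => by linarith) (fun h => by linarith)
    have e5 : oddInd (B + k) (B + k) = 1 := oddInd_self (fun h => by linarith)
    have e6 : 0 ≤ oddInd k (B + k) := oddInd_nonneg (fun h => by linarith)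
    rw [e4, e5] at hx
    linarith [mul_nonneg (mul_pos hp hq).le e6]
  rw [neg_zero] at hr
  linarith [key m h, key (-m) hr]

/-- Here the second distribution has only its two end atoms, so three differences remain and `n` is
immaterial. The atom at `A - B`, with coefficient `1 - ρ ^ 2`, must absorb those at `B ± m`. -/
lemma Balanced.of_middle_zero {A B m n ρ p : ℝ} (h : Balanced A B m n ρ p 0) (hB : 0 < B)
    (hmA : m < A) (hAm : -A < m) (hρ : 1 ≤ ρ) (hp : 0 < p) :
    (m = 0 ∧ ρ = 1) ∨ (1 < ρ ∧ A = 3 * m ∧ p * ρ = ρ ^ 2 - 1) ∨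
      (1 < ρ ∧ m = 0 ∧ p = 1 + ρ) := by
  have hpρ : 0 < p * ρ := by positivity
  have hρ2 : 0 ≤ ρ ^ 2 - 1 := by nlinarith
  simp only [Balanced, zero_mul, mul_zero, add_zero, sub_zero] at h
  rcases lt_trichotomy m 0 with hm | rfl | hm
  · exfalso
    have hx := h (B - m)
    have e1 : 0 ≤ oddInd (A - B) (B - m) := oddInd_nonneg (fun h => by linarith)
    have e4 : oddInd (B - m) (B - m) = 1 := oddInd_self (fun h => by linarith)
    have e5 : oddInd (B + m) (B - m) = 0 :=
      oddInd_eq_zero (fun h => by linarith) (fun h => by linarith)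
    rw [e4, e5] at hx
    linarith [mul_nonneg hρ2 e1]
  · rcases hρ.eq_or_lt with rfl | hρ1
    · exact .inl ⟨rfl, rfl⟩
    have hx := h B
    have e4 : oddInd B B = 1 := oddInd_self hB.ne'
    rw [sub_zero, add_zero, e4] at hx
    have hA : A - B = B := by
      by_contra hne
      have e1 : oddInd (A - B) B = 0 := oddInd_eq_zero hne (fun h => by linarith)
      rw [e1] at hx
      nlinarith [mul_pos hp (sub_pos.2 hρ1)]
    rw [hA, e4] at hx
    have : (ρ - 1) * (p - (1 + ρ)) = 0 := by linarith
    rcases mul_eq_zero.1 this with h | h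
    · linarith
    · exact .inr (.inr ⟨hρ1, rfl, by linarith⟩)
  · have hx := h (B + m)
    have e4 : oddInd (B - m) (B + m) = 0 :=
      oddInd_eq_zero (fun h => by linarith) (fun h => by linarith)
    have e5 : oddInd (B + m) (B + m) = 1 := oddInd_self (fun h => by linarith)
    rw [e4, e5] at hx
    have hA : A - B = B + m := by
      by_contra hne
      have e1 : oddInd (A - B) (B + m) = 0 := oddInd_eq_zero hne (fun h => by linarith)
      rw [e1] at hx
      linarith
    rw [hA, e5] at hx
    have hBm : B = m := by
      by_contra hne
      have hy := h (B - m)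
      have f4 : oddInd (B - m) (B - m) = 1 := oddInd_self (fun h => hne (by linarith))
      have f5 : oddInd (B + m) (B - m) = 0 :=
        oddInd_eq_zero (fun h => by linarith) (fun h => by linarith)
      rw [hA, f4, f5] at hy
      linarith
    refine .inr (.inl ⟨?_, by linarith, by linarith⟩)
    rcases hρ.eq_or_lt with rfl | hρ1
    · linarith
    · exact hρ1

/-- The exceptional shapes of the three-point distribution with weights `(ρ, p, 1)` at
`(-A, m, A)`. -/
def Exceptional (A m ρ p : ℝ) : Prop :=
  1 < ρ ∧ ((A = 3 * m ∧ p * ρ = ρ ^ 2 - 1) ∨ (m = 0 ∧ p = 1 + ρ) ∨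
    (A = 2 * m ∧ p ^ 2 * ρ = (ρ - 1) ^ 2 * (ρ + 1)) ∨ (m = 0 ∧ p ^ 2 = ρ + ρ ^ 2))

lemma Balanced.exceptional_of_lt {A B m n ρ p q : ℝ} (h : Balanced A B m n ρ p q) (hB : 0 < B)
    (hAB : B < A) (hmA : m < A) (hAm : -A < m) (hnB : n < B) (hBn : -B < n)
    (hρ : 1 < ρ) (hp : 0 < p) (hq : 0 < q) :
    Exceptional A m ρ p ∧ Exceptional B n ρ q := by
  obtain ⟨hn, hm, hpq, ⟨h1, h2⟩ | ⟨h1, h2⟩⟩ := h.of_lt hB hAB hmA hAm hnB hBn hρ hp hq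
  · have hq2 : q ^ 2 = ρ + ρ ^ 2 := by
      -- Eliminating `p` between the two weight equations leaves a polynomial in `q` and `ρ`
      -- divisible by `ρ - 1`; the second branch does the same.
      have : (ρ - 1) * (q ^ 2 - (ρ + ρ ^ 2)) = 0 := by linear_combination q * hpq + ρ * h2
      rcases mul_eq_zero.1 this with h | h <;> linarith
    refine ⟨⟨hρ, .inr (.inr (.inl ⟨by linarith, ?_⟩))⟩, hρ, .inr (.inr (.inr ⟨hn, hq2⟩))⟩
    have : ρ * (p ^ 2 * ρ - (ρ - 1) ^ 2 * (ρ + 1)) = 0 := by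
      linear_combination (-(p * ρ) - q * (ρ - 1)) * hpq + (ρ - 1) ^ 2 * hq2
    rcases mul_eq_zero.1 this with h | h <;> linarith
  · have hq2 : q = 1 + ρ := by
      have : (ρ - 1) * ((q + ρ) * (q - (1 + ρ))) = 0 := by
        linear_combination (q - 1) * hpq + ρ * h2
      rcases mul_eq_zero.1 this with h | h
      · linarith
      rcases mul_eq_zero.1 h with h | h <;> linarith
    refine ⟨⟨hρ, .inl ⟨by linarith, ?_⟩⟩, hρ, .inr (.inl ⟨hn, hq2⟩)⟩
    rw [← hpq, hq2]
    ring

/-- Classification of the balanced pairs with `1 ≤ ρ`. -/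
lemma Balanced.classification {A B m n ρ p q : ℝ} (h : Balanced A B m n ρ p q)
    (hmA : m < A) (hAm : -A < m) (hnB : n < B) (hBn : -B < n)
    (hρ : 1 ≤ ρ) (hp : 0 < p) (hq : 0 ≤ q) :
    (m = 0 ∧ ρ = 1) ∨ (A = B ∧ m = n ∧ p = q) ∨ Exceptional A m ρ p := by
  have hB : 0 < B := by linarith
  have hA : 0 < A := by linarith
  rcases hq.eq_or_lt with rfl | hq
  · rcases h.of_middle_zero hB hmA hAm hρ hp with h | ⟨h, h'⟩ | ⟨h, h'⟩
    · exact .inl h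
    · exact .inr (.inr ⟨h, .inl h'⟩)
    · exact .inr (.inr ⟨h, .inr (.inl h')⟩)
  rcases lt_trichotomy A B with hAB | rfl | hAB
  · rcases hρ.eq_or_lt with rfl | hρ1
    · exact .inl ⟨(h.swap.of_lt_of_one hAB hnB hBn hmA hAm hq hp).2, rfl⟩
    · exact .inr (.inr (h.swap.exceptional_of_lt hA hAB hnB hBn hmA hAm hρ1 hq hp).2)
  · rcases h.of_eq hmA hAm hnB hBn (by linarith) hp hq with h | h
    · exact .inl h
    · exact .inr (.inl ⟨rfl, h⟩)
  · rcases hρ.eq_or_lt with rfl | hρ1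
    · exact .inl ⟨(h.of_lt_of_one hAB hmA hAm hnB hBn hp hq).1, rfl⟩
    · exact .inr (.inr (h.exceptional_of_lt hB hAB hmA hAm hnB hBn hρ1 hp hq).1)

/-! ### From centred shapes back to parameters -/

lemma mem_setA_of_exceptional {θ : Param 3} (hθ : θ ∈ Omega 3) {s A m ρ p l : ℝ}
    (hx : θ.2 = ![s - A, s + m, s + A]) (hw : θ.1 = ![l * ρ, l * p, l]) (hA : 0 < A)
    (hp : 0 < p) (hl : 0 < l) (h : Exceptional A m ρ p) : θ ∈ setA := by
  obtain ⟨hρ, h⟩ := h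
  have hρ0 : 0 < ρ := by linarith
  rcases h with ⟨h1, h2⟩ | ⟨rfl, h2⟩ | ⟨h1, h2⟩ | ⟨rfl, h2⟩
  · refine ⟨hθ, s - A, m, ρ, by linarith, hρ, .inl ⟨?_, l / ρ, by positivity, ?_⟩⟩
    · rw [hx, h1]
      ext i
      fin_cases i <;> simp <;> ring
    · have e1 : l / ρ * ρ ^ 2 = l * ρ := by field_simp
      have e2 : l / ρ * (ρ ^ 2 - 1) = l * p := by rw [← h2]; field_simp
      have e3 : l / ρ * ρ = l := by field_simp
      rw [hw]
      simp [e1, e2, e3]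
  -- The equal gaps `A` are `2d` here, and the first location is `c + d`: the origin `c` is the
  -- first location of the companion.
  · refine ⟨hθ, s - A - A / 2, A / 2, ρ, by linarith, hρ, .inr (.inl ⟨?_, l, hl, ?_⟩)⟩
    · rw [hx]
      ext i
      fin_cases i <;> simp <;> ring
    · rw [hw, h2]
      simp [add_comm]
  · refine ⟨hθ, s - A, m, ρ, by linarith, hρ,
      .inr (.inr (.inl ⟨?_, l / √ρ, by positivity, ?_⟩))⟩
    · rw [hx, h1]
      ext i
      fin_cases i <;> simp <;> ring
    · have hs : 0 < √ρ := Real.sqrt_pos.2 hρ0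
      have e1 : l / √ρ * (ρ * √ρ) = l * ρ := by field_simp
      have e0 : (ρ - 1) * √(ρ + 1) = p * √ρ := by
        have ha : 0 ≤ (ρ - 1) * √(ρ + 1) := mul_nonneg (by linarith) (Real.sqrt_nonneg _)
        rw [← pow_left_inj₀ ha (by positivity) two_ne_zero, mul_pow, mul_pow,
          Real.sq_sqrt hρ0.le, Real.sq_sqrt (by linarith), h2]
      have e2 : l / √ρ * ((ρ - 1) * √(ρ + 1)) = l * p := by rw [e0]; field_simp
      have e3 : l / √ρ * √ρ = l := by field_simp
      rw [hw]
      simp [e1, e2, e3]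
  · refine ⟨hθ, s - A - A, A, ρ, by linarith, hρ, .inr (.inr (.inr ⟨?_, l, hl, ?_⟩))⟩
    · rw [hx]
      ext i
      fin_cases i <;> simp <;> ring
    · rw [hw, ← h2, Real.sqrt_sq hp.le]
      simp

lemma isSymmetric_Delta_iff {θ : Param 3} (hθ : θ ∈ Omega 3) :
    IsSymmetric (Delta θ) ↔ ∃ s : ℝ, ∀ t, ∑ i, θ.1 i * Real.sin (t * (θ.2 i - s)) = 0 := by
  have hprob := isProbabilityMeasure_Delta hθ
  have hmap : ∀ s t : ℝ, (charFun ((Delta θ).map (fun x => x + -s)) t).im =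
      ∑ i, θ.1 i * Real.sin (t * (θ.2 i - s)) := by
    intro s t
    rw [charFun_map_add_const, charFun_Delta hθ, Finset.sum_mul, Complex.im_sum]
    refine Finset.sum_congr rfl fun i _ => ?_
    rw [mul_assoc, ← Complex.exp_add, Complex.im_ofReal_mul, ← Complex.exp_ofReal_mul_I_im]
    congr 3
    simp
    ring
  constructor
  · rintro ⟨G, hG, s, h⟩
    refine ⟨s, fun t => ?_⟩
    rw [← hmap, h, Measure.map_map (by fun_prop) (by fun_prop)]
    have : (fun x : ℝ => x + -s) ∘ (fun x => x + s) = id := by ext; simp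
    rw [this, Measure.map_id]
    exact (mem_zeroSymmetric_iff.1 hG).2 t
  · rintro ⟨s, h⟩
    have hp : IsProbabilityMeasure ((Delta θ).map (fun x => x + -s)) :=
      Measure.isProbabilityMeasure_map (by fun_prop)
    refine ⟨(Delta θ).map (fun x => x + -s),
      mem_zeroSymmetric_iff.2 ⟨hp, fun t => by rw [hmap, h]⟩, s, ?_⟩
    rw [Measure.map_map (by fun_prop) (by fun_prop)]
    have : (fun x : ℝ => x + s) ∘ (fun x => x + -s) = id := by ext; simp
    rw [this, Measure.map_id]

lemma vec_three_eq (v : Fin 3 → ℝ) : v = ![v 0, v 1, v 2] := by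
  ext i
  fin_cases i <;> rfl

lemma three_lt_of_strictMono {v : Fin 3 → ℝ} (h : StrictMono v) : v 0 < v 1 ∧ v 1 < v 2 :=
  ⟨h (by decide), h (by decide)⟩

lemma strictMono_three {a b c : ℝ} (hab : a < b) (hbc : b < c) : StrictMono ![a, b, c] := by
  rw [Fin.strictMono_iff_lt_succ]
  intro i
  fin_cases i <;> simpa

lemma mem_Omega_three {p q r a b c : ℝ} (hp : 0 ≤ p) (hq : 0 ≤ q) (hr : 0 ≤ r)
    (h : p + q + r = 1) (hab : a < b) (hbc : b < c) :
    ((![p, q, r], ![a, b, c]) : Param 3) ∈ Omega 3 := by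
  refine ⟨fun j => ?_, ?_, strictMono_three hab hbc⟩
  · fin_cases j <;> simpa
  · simpa [Fin.sum_univ_three] using h

/-- The reflection of a parameter about zero. -/
def reflect (θ : Param 3) : Param 3 :=
  (![θ.1 2, θ.1 1, θ.1 0], ![-θ.2 2, -θ.2 1, -θ.2 0])

lemma reflect_mem_Omega {θ : Param 3} (hθ : θ ∈ Omega 3) : reflect θ ∈ Omega 3 := by
  obtain ⟨h1, h2⟩ := three_lt_of_strictMono hθ.2.2
  have hs := hθ.2.1
  rw [Fin.sum_univ_three] at hs
  exact mem_Omega_three (hθ.1 2) (hθ.1 1) (hθ.1 0) (by linarith) (by linarith) (by linarith)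

lemma reflect_reflect (θ : Param 3) : reflect (reflect θ) = θ := by
  refine Prod.ext ?_ ?_
  · ext i; fin_cases i <;> simp [reflect]
  · ext i; fin_cases i <;> simp [reflect]

/-- The largest difference `a 2 - b 0` and the smallest `a 0 - b 2` are each attained by a single
pair of atoms, so they must be opposite and carry equal mass. -/
lemma ends_balanced {l k a b : Fin 3 → ℝ} (ha : StrictMono a) (hb : StrictMono b)
    (hl : ∀ i, 0 < l i) (hk0 : 0 < k 0) (hk2 : 0 < k 2)
    (h : ∀ x, ∑ i, ∑ j, l i * k j * oddInd (a i - b j) x = 0) :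
    a 2 - b 0 = b 2 - a 0 ∧ l 2 * k 0 = l 0 * k 2 := by
  obtain ⟨ha1, ha2⟩ := three_lt_of_strictMono ha
  obtain ⟨hb1, hb2⟩ := three_lt_of_strictMono hb
  simp only [Fin.sum_univ_three] at h
  have h20 : 0 < l 2 * k 0 := mul_pos (hl 2) hk0
  have h02 : 0 < l 0 * k 2 := mul_pos (hl 0) hk2
  by_cases hz : a 2 - b 0 = b 2 - a 0
  · refine ⟨hz, ?_⟩
    have hx := h (a 2 - b 0)
    have e20 : oddInd (a 2 - b 0) (a 2 - b 0) = 1 := oddInd_self (fun h => by linarith)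
    have e02 : oddInd (a 0 - b 2) (a 2 - b 0) = -1 := by
      rw [← neg_sub, ← hz, oddInd_neg, e20]
    have e : ∀ i j, a i - b j < a 2 - b 0 → a 0 - b 2 < a i - b j →
        oddInd (a i - b j) (a 2 - b 0) = 0 := fun i j h1 h2 =>
      oddInd_eq_zero (fun h => by linarith) (fun h => by linarith)
    rw [e20, e02, e 0 0 (by linarith) (by linarith), e 0 1 (by linarith) (by linarith),
      e 1 0 (by linarith) (by linarith), e 1 1 (by linarith) (by linarith),
      e 1 2 (by linarith) (by linarith), e 2 1 (by linarith) (by linarith),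
      e 2 2 (by linarith) (by linarith)] at hx
    linarith
  · exfalso
    rcases lt_or_gt_of_ne hz with hlt | hlt
    · have hx := h (b 2 - a 0)
      have hpos : 0 < b 2 - a 0 := by linarith
      have e02 : oddInd (a 0 - b 2) (b 2 - a 0) = -1 := by
        rw [← neg_sub, oddInd_neg, oddInd_self hpos.ne']
      have e : ∀ i j, a i - b j < b 2 - a 0 → a 0 - b 2 < a i - b j →
          oddInd (a i - b j) (b 2 - a 0) = 0 := fun i j h1 h2 =>
        oddInd_eq_zero (fun h => by linarith) (fun h => by linarith)
      rw [e02, e 0 0 (by linarith) (by linarith), e 0 1 (by linarith) (by linarith),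
        e 1 0 (by linarith) (by linarith), e 1 1 (by linarith) (by linarith),
        e 1 2 (by linarith) (by linarith), e 2 0 (by linarith) (by linarith),
        e 2 1 (by linarith) (by linarith), e 2 2 (by linarith) (by linarith)] at hx
      linarith
    · have hx := h (a 2 - b 0)
      have hpos : 0 < a 2 - b 0 := by linarith
      have e20 : oddInd (a 2 - b 0) (a 2 - b 0) = 1 := oddInd_self hpos.ne'
      have e : ∀ i j, a i - b j < a 2 - b 0 → b 0 - a 2 < a i - b j →
          oddInd (a i - b j) (a 2 - b 0) = 0 := fun i j h1 h2 =>
        oddInd_eq_zero (fun h => by linarith) (fun h => by linarith)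
      rw [e20, e 0 0 (by linarith) (by linarith), e 0 1 (by linarith) (by linarith),
        e 0 2 (by linarith) (by linarith), e 1 0 (by linarith) (by linarith),
        e 1 1 (by linarith) (by linarith), e 1 2 (by linarith) (by linarith),
        e 2 1 (by linarith) (by linarith), e 2 2 (by linarith) (by linarith)] at hx
      linarith

/-- The differences `±(A + B)` both have mass `ρ` and cancel; the common factor `l * k` divides out.
-/
lemma balanced_of_sum {s A B m n ρ p q l k : ℝ} (hl : 0 < l) (hk : 0 < k)
    (h : ∀ x, ∑ i, ∑ j, ![l * ρ, l * p, l] i * ![k * ρ, k * q, k] j *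
      oddInd (![s - A, s + m, s + A] i - ![s - B, s + n, s + B] j) x = 0) :
    Balanced A B m n ρ p q := by
  intro x
  have hx := h x
  simp only [Fin.sum_univ_three, Matrix.cons_val_zero, Matrix.cons_val_one,
    Matrix.cons_val] at hx
  rw [show s - A - (s - B) = -(A - B) by ring, show s - A - (s + n) = -(A + n) by ring,
    show s - A - (s + B) = -(A + B) by ring, show s + m - (s - B) = B + m by ring,
    show s + m - (s + n) = m - n by ring, show s + m - (s + B) = -(B - m) by ring,
    show s + A - (s - B) = A + B by ring, show s + A - (s + n) = A - n by ring,
    show s + A - (s + B) = A - B by ring] at hx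
  simp only [oddInd_neg] at hx
  refine (mul_eq_zero.1 ?_).resolve_left (mul_pos hl hk).ne'
  · linear_combination hx

lemma isSymmetric_of_centered {θ : Param 3} (hθ : θ ∈ Omega 3) (hw : θ.1 0 = θ.1 2)
    (hx : θ.2 0 + θ.2 2 = 2 * θ.2 1) : IsSymmetric (Delta θ) := by
  refine (isSymmetric_Delta_iff hθ).2 ⟨θ.2 1, fun t => ?_⟩
  rw [Fin.sum_univ_three, show θ.2 0 - θ.2 1 = -(θ.2 2 - θ.2 1) by linarith, mul_neg,
    Real.sin_neg, sub_self, mul_zero, Real.sin_zero, hw]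
  ring

/-- The weights `k` are not normalised and `k 1` may vanish, so a two-point distribution is covered
by adding a weightless middle location. -/
lemma classification_of_ends {θ : Param 3} (hθ : θ ∈ Omega 3) (hpos : ∀ i, 0 < θ.1 i)
    {k b : Fin 3 → ℝ} (hb : StrictMono b) (hk0 : 0 < k 0) (hk1 : 0 ≤ k 1) (hk2 : 0 < k 2)
    (h : ∀ x, ∑ i, ∑ j, θ.1 i * k j * oddInd (θ.2 i - b j) x = 0) :
    θ ∈ setA ∪ setAneg ∪ setB ∨
      (θ.2 = b ∧ θ.1 0 * k 2 = θ.1 2 * k 0 ∧ θ.1 1 * k 2 = θ.1 2 * k 1) := by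
  obtain ⟨hends, hratio⟩ := ends_balanced hθ.2.2 hb hpos hk0 hk2 h
  obtain ⟨ha1, ha2⟩ := three_lt_of_strictMono hθ.2.2
  obtain ⟨hb1, hb2⟩ := three_lt_of_strictMono hb
  have hl0 := hpos 0
  have hl1 := hpos 1
  have hl2 := hpos 2
  obtain ⟨s, hs⟩ : ∃ s, s = (θ.2 0 + θ.2 2) / 2 := ⟨_, rfl⟩
  obtain ⟨A, hA⟩ : ∃ A, A = (θ.2 2 - θ.2 0) / 2 := ⟨_, rfl⟩
  obtain ⟨B, hB⟩ : ∃ B, B = (b 2 - b 0) / 2 := ⟨_, rfl⟩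
  obtain ⟨m, hm⟩ : ∃ m, m = θ.2 1 - s := ⟨_, rfl⟩
  obtain ⟨n, hn⟩ : ∃ n, n = b 1 - s := ⟨_, rfl⟩
  obtain ⟨ρ, hρ⟩ : ∃ ρ, ρ = θ.1 0 / θ.1 2 := ⟨_, rfl⟩
  obtain ⟨p, hp⟩ : ∃ p, p = θ.1 1 / θ.1 2 := ⟨_, rfl⟩
  obtain ⟨q, hq⟩ : ∃ q, q = k 1 / k 2 := ⟨_, rfl⟩
  have hρ0 : 0 < ρ := by rw [hρ]; positivity
  have hp0 : 0 < p := by rw [hp]; positivity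
  have hq0 : 0 ≤ q := by rw [hq]; positivity
  have w0 : θ.1 2 * ρ = θ.1 0 := by rw [hρ]; field_simp
  have w1 : θ.1 2 * p = θ.1 1 := by rw [hp]; field_simp
  have v0 : k 2 * ρ = k 0 := by rw [hρ]; field_simp; linarith
  have v1 : k 2 * q = k 1 := by rw [hq]; field_simp
  have hx : θ.2 = ![s - A, s + m, s + A] := by
    rw [vec_three_eq θ.2]; congr 1; · linarith
    congr 1; · linarith
    congr 1; linarith
  have hy : b = ![s - B, s + n, s + B] := by
    rw [vec_three_eq b]; congr 1; · linarith
    congr 1; · linarith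
    congr 1; linarith
  have hw : θ.1 = ![θ.1 2 * ρ, θ.1 2 * p, θ.1 2] := by
    rw [w0, w1]; exact vec_three_eq θ.1
  have hv : k = ![k 2 * ρ, k 2 * q, k 2] := by
    rw [v0, v1]; exact vec_three_eq k
  have hbal : Balanced A B m n ρ p q := by
    refine balanced_of_sum hl2 hk2 (s := s) fun x => ?_
    rw [← hw, ← hv, ← hx, ← hy]
    exact h x
  rcases le_total 1 ρ with h1 | h1
  · rcases hbal.classification (by linarith) (by linarith) (by linarith) (by linarith) h1 hp0 hq0
      with ⟨h2, h3⟩ | ⟨h2, h3, h4⟩ | h2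
    · refine .inl (.inr ⟨hθ, .inl (isSymmetric_of_centered hθ ?_ ?_)⟩)
      · rw [← w0, h3, mul_one]
      · linarith
    · refine .inr ⟨by rw [hx, hy, h2, h3], by linarith, ?_⟩
      rw [← w1, ← v1, h4]; ring
    · exact .inl (.inl (.inl
        (mem_setA_of_exceptional hθ hx hw (by linarith) hp0 hl2 h2)))
  · rcases (hbal.reflect hρ0).classification (by linarith) (by linarith) (by linarith)
      (by linarith) ((one_le_inv₀ hρ0).2 h1) (by positivity) (by positivity)
      with ⟨h2, h3⟩ | ⟨h2, h3, h4⟩ | h2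
    · refine .inl (.inr ⟨hθ, .inl (isSymmetric_of_centered hθ ?_ ?_)⟩)
      · rw [← w0, inv_eq_one.1 h3, mul_one]
      · linarith
    · have h5 : p = q := mul_right_cancel₀ (inv_ne_zero hρ0.ne') h4
      refine .inr ⟨by rw [hx, hy, h2, neg_inj.1 h3], by linarith, ?_⟩
      rw [← w1, ← v1, h5]; ring
    · refine .inl (.inl (.inr ⟨hθ, mem_setA_of_exceptional (reflect_mem_Omega hθ)
        (s := -s) (l := θ.1 0) ?_ ?_ (by linarith) (by positivity) hl0 h2⟩))
      · ext i
        fin_cases i <;> simp <;> linarith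
      · have e1 : θ.1 0 * ρ⁻¹ = θ.1 2 := by rw [← w0]; field_simp
        have e2 : θ.1 0 * (p * ρ⁻¹) = θ.1 1 := by rw [← w0, ← w1]; field_simp
        rw [e1, e2]

lemma Compat.oddInd_sum_eq_zero {k : ℕ} {θ θ' : Param k} (hθ : θ ∈ Omega k)
    (hθ' : θ' ∈ Omega k) (h : Compat θ θ') (x : ℝ) :
    ∑ i, ∑ j, θ.1 i * θ'.1 j * oddInd (θ.2 i - θ'.2 j) x = 0 := by
  have := h.mass_eq hθ hθ' x
  simp only [oddInd, mul_sub, Finset.sum_sub_distrib]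
  exact sub_eq_zero.2 this

lemma Compat.eq_or_mem {θ θ' : Param 3} (hθ : θ ∈ Omega 3) (hpos : ∀ i, 0 < θ.1 i)
    (hθ' : θ' ∈ Omega 3) (h : Compat θ θ') :
    θ ∈ setA ∪ setAneg ∪ setB ∨ θ' = θ := by
  have hodd := h.oddInd_sum_eq_zero hθ hθ'
  obtain ⟨hb1, hb2⟩ := three_lt_of_strictMono hθ'.2.2
  have hsum := hθ.2.1
  have hsum' := hθ'.2.1
  rw [Fin.sum_univ_three] at hsum hsum'
  have point : ∀ j : Fin 3, (∀ i, i ≠ j → θ'.1 i = 0) → θ ∈ setA ∪ setAneg ∪ setB := by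
    intro j hj
    refine .inr ⟨hθ, .inl ((isSymmetric_Delta_iff hθ).2 ⟨θ'.2 j, fun t => ?_⟩)⟩
    have hj1 : θ'.1 j = 1 := by
      rw [← hθ'.2.1]
      exact (Finset.sum_eq_single j (fun i _ hi => hj i hi) (by simp)).symm
    rw [← h t]
    refine Finset.sum_congr rfl fun i _ => ?_
    rw [Finset.sum_eq_single j (fun i _ hi => by rw [hj i hi]; ring) (by simp), hj1, mul_one]
  have pair : ∀ u v : Fin 3, θ'.2 u < θ'.2 v → 0 < θ'.1 u → 0 < θ'.1 v →
      (∀ f : Fin 3 → ℝ, ∑ j, θ'.1 j * f j = θ'.1 u * f u + θ'.1 v * f v) →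
      θ ∈ setA ∪ setAneg ∪ setB := by
    intro u v huv hu hv hsub
    have hm : StrictMono ![θ'.2 u, (θ'.2 u + θ'.2 v) / 2, θ'.2 v] :=
      strictMono_three (by linarith) (by linarith)
    refine (classification_of_ends hθ hpos (k := ![θ'.1 u, 0, θ'.1 v]) hm hu le_rfl hv
      fun x => ?_).resolve_right ?_
    · refine (Finset.sum_congr rfl fun i _ => ?_).trans (hodd x)
      have := hsub fun j => θ.1 i * oddInd (θ.2 i - θ'.2 j) x
      rw [Fin.sum_univ_three]
      simp only [Matrix.cons_val_zero, Matrix.cons_val_one, Matrix.cons_val]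
      calc _ = θ'.1 u * (θ.1 i * oddInd (θ.2 i - θ'.2 u) x) +
            θ'.1 v * (θ.1 i * oddInd (θ.2 i - θ'.2 v) x) := by ring
        _ = _ := this.symm
        _ = _ := Finset.sum_congr rfl fun j _ => by ring
    · rintro ⟨-, -, h1⟩
      have h1 : θ.1 1 * θ'.1 v = θ.1 2 * 0 := h1
      rw [mul_zero] at h1
      exact (mul_pos (hpos 1) hv).ne' h1
  rcases (hθ'.1 0).eq_or_lt with h0 | h0 <;> rcases (hθ'.1 2).eq_or_lt with h2 | h2
  · exact .inl (point 1 fun i hi => by fin_cases i <;> simp_all)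
  · rcases (hθ'.1 1).eq_or_lt with h1 | h1
    · exact .inl (point 2 fun i hi => by fin_cases i <;> simp_all)
    · exact .inl (pair 1 2 hb2 h1 h2 fun f => by rw [Fin.sum_univ_three, ← h0]; ring)
  · rcases (hθ'.1 1).eq_or_lt with h1 | h1
    · exact .inl (point 0 fun i hi => by fin_cases i <;> simp_all)
    · exact .inl (pair 0 1 hb1 h0 h1 fun f => by rw [Fin.sum_univ_three, ← h2]; ring)
  · rcases classification_of_ends hθ hpos hθ'.2.2 h0 (hθ'.1 1) h2 hodd with h3 | ⟨h3, h4, h5⟩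
    · exact .inl h3
    refine .inr (Prod.ext ?_ h3.symm)
    -- Proportional weight vectors with the same sum are equal.
    have e2 : θ'.1 2 = θ.1 2 := by
      linear_combination (-θ'.1 2) * hsum + h4 + h5 + θ.1 2 * hsum'
    rw [e2] at h4 h5
    have hl := (hpos 2).ne'
    have e0 : θ'.1 0 = θ.1 0 := mul_left_cancel₀ hl (by linarith)
    have e1 : θ'.1 1 = θ.1 1 := mul_left_cancel₀ hl (by linarith)
    rw [vec_three_eq θ'.1, vec_three_eq θ.1, e0, e1, e2]

/-! ### Explicit companions for the excluded parameters -/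

lemma compat_caseOne {c d r : ℝ} {θ θ' : Param 3} (h : CaseOne c d r θ)
    (h' : CaseOne' c d r θ') : Compat θ θ' := by
  obtain ⟨hx, s, -, hw⟩ := h
  obtain ⟨hx', s', -, hw'⟩ := h'
  intro t
  rw [hx, hx', hw, hw']
  simp only [Fin.sum_univ_three, Pi.smul_apply, smul_eq_mul, Matrix.cons_val_zero,
    Matrix.cons_val_one, Matrix.cons_val]
  rw [show t * (c - (c + d)) = -(t * d) by ring,
    show t * (c - (c + 3 * d)) = -(3 * (t * d)) by ring,
    show t * (c - (c + 5 * d)) = -(5 * (t * d)) by ring,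
    show t * (c + 4 * d - (c + d)) = 3 * (t * d) by ring,
    show t * (c + 4 * d - (c + 3 * d)) = t * d by ring,
    show t * (c + 4 * d - (c + 5 * d)) = -(t * d) by ring,
    show t * (c + 6 * d - (c + d)) = 5 * (t * d) by ring,
    show t * (c + 6 * d - (c + 3 * d)) = 3 * (t * d) by ring,
    show t * (c + 6 * d - (c + 5 * d)) = t * d by ring]
  simp only [Real.sin_neg]
  ring

lemma compat_caseTwo {c d r : ℝ} (hr : 1 < r) {θ θ' : Param 3} (h : CaseTwo c d r θ)
    (h' : CaseTwo' c d r θ') : Compat θ θ' := by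
  obtain ⟨hx, s, -, hw⟩ := h
  obtain ⟨hx', s', -, hw'⟩ := h'
  have hq : √(r + r ^ 2) = √r * √(r + 1) := by
    rw [← Real.sqrt_mul (by linarith)]
    congr 1
    ring
  have h1 : √(r + 1) ^ 2 = r + 1 := Real.sq_sqrt (by linarith)
  have h2 : √r ^ 2 = r := Real.sq_sqrt (by linarith)
  intro t
  rw [hx, hx', hw, hw', hq]
  simp only [Fin.sum_univ_three, Pi.smul_apply, smul_eq_mul, Matrix.cons_val_zero,
    Matrix.cons_val_one, Matrix.cons_val]
  rw [show t * (c - (c + d)) = -(t * d) by ring,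
    show t * (c - (c + 2 * d)) = -(2 * (t * d)) by ring,
    show t * (c - (c + 3 * d)) = -(3 * (t * d)) by ring,
    show t * (c + 3 * d - (c + d)) = 2 * (t * d) by ring,
    show t * (c + 3 * d - (c + 2 * d)) = t * d by ring,
    show t * (c + 3 * d - (c + 3 * d)) = 0 by ring,
    show t * (c + 4 * d - (c + d)) = 3 * (t * d) by ring,
    show t * (c + 4 * d - (c + 2 * d)) = 2 * (t * d) by ring,
    show t * (c + 4 * d - (c + 3 * d)) = t * d by ring]
  simp only [Real.sin_neg, Real.sin_zero]
  -- The `sin (3td)` terms cancel identically; `sin (td)` needs the square of `√(r + 1)` and `sin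
  -- (2td)` that of `√r`.
  linear_combination s * s' * (r - 1) * √r * Real.sin (t * d) * h1 +
    s * s' * (1 - r) * √(r + 1) * Real.sin (2 * (t * d)) * h2

lemma exists_mem_Omega_of_weights {u v w a b c : ℝ} (hu : 0 ≤ u) (hv : 0 ≤ v) (hw : 0 < w)
    (hab : a < b) (hbc : b < c) :
    ∃ θ ∈ Omega 3, θ.2 = ![a, b, c] ∧ Proportional θ.1 ![u, v, w] := by
  have hs : 0 < u + v + w := by linarith
  refine ⟨_, mem_Omega_three (p := (u + v + w)⁻¹ * u) (q := (u + v + w)⁻¹ * v)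
    (r := (u + v + w)⁻¹ * w) (by positivity) (by positivity) (by positivity)
    (by field_simp) hab hbc, rfl, (u + v + w)⁻¹, by positivity, ?_⟩
  simp

lemma exists_compat_of_mem_setA {θ : Param 3} (h : θ ∈ setA) :
    ∃ θ' ∈ Omega 3, Compat θ θ' ∧ θ' ≠ θ := by
  obtain ⟨-, c, d, r, hd, hr, h⟩ := h
  have hr0 : 0 < r := by linarith
  have hr1 : 0 < r - 1 := by linarith
  have hr2 : 0 < r ^ 2 - 1 := by nlinarith
  have hne : ∀ {θ' : Param 3}, θ'.2 0 ≠ θ.2 0 → θ' ≠ θ := fun h e => h (by rw [e])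
  rcases h with h | h | h | h
  · obtain ⟨θ', hθ', h'⟩ := exists_mem_Omega_of_weights (u := r) (v := r + 1) (w := 1)
      (a := c + d) (b := c + 3 * d) (c := c + 5 * d) (by linarith) (by linarith) one_pos
      (by linarith) (by linarith)
    refine ⟨θ', hθ', compat_caseOne h h', hne ?_⟩
    rw [h'.1, h.1]
    simp [hd.ne']
  · obtain ⟨θ', hθ', h'⟩ := exists_mem_Omega_of_weights (u := r ^ 2) (v := r ^ 2 - 1) (w := r)
      (a := c) (b := c + 4 * d) (c := c + 6 * d) (by positivity) hr2.le hr0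
      (by linarith) (by linarith)
    refine ⟨θ', hθ', (compat_caseOne h' h).symm, hne ?_⟩
    rw [h'.1, h.1]
    simp [hd.ne']
  · obtain ⟨θ', hθ', h'⟩ := exists_mem_Omega_of_weights (u := r) (v := √(r + r ^ 2)) (w := 1)
      (a := c + d) (b := c + 2 * d) (c := c + 3 * d) (by linarith) (by positivity) one_pos
      (by linarith) (by linarith)
    refine ⟨θ', hθ', compat_caseTwo hr h h', hne ?_⟩
    rw [h'.1, h.1]
    simp [hd.ne']
  · obtain ⟨θ', hθ', h'⟩ := exists_mem_Omega_of_weights (u := r * √r)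
      (v := (r - 1) * √(r + 1)) (w := √r)
      (a := c) (b := c + 3 * d) (c := c + 4 * d) (by positivity) (by positivity) (by positivity)
      (by linarith) (by linarith)
    refine ⟨θ', hθ', (compat_caseTwo hr h' h).symm, hne ?_⟩
    rw [h'.1, h.1]
    simp [hd.ne']

lemma Compat.reflect {θ θ' : Param 3} (h : Compat θ θ') :
    Compat (reflect θ) (reflect θ') := by
  intro t
  have ht := h (-t)
  simp only [Fin.sum_univ_three] at ht
  simp only [SymMixture.reflect, Fin.sum_univ_three, Matrix.cons_val_zero, Matrix.cons_val_one,
    Matrix.cons_val]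
  have e : ∀ x y : ℝ, t * (-x - -y) = -t * (x - y) := fun x y => by ring
  simp only [e]
  linarith

lemma exists_compat_of_mem_setAneg {θ : Param 3} (h : θ ∈ setAneg) :
    ∃ θ' ∈ Omega 3, Compat θ θ' ∧ θ' ≠ θ := by
  obtain ⟨θ', hθ', hc, hne⟩ := exists_compat_of_mem_setA h.2
  refine ⟨reflect θ', reflect_mem_Omega hθ', ?_, fun e => hne ?_⟩
  · rw [← reflect_reflect θ]
    exact hc.reflect
  · rw [← reflect_reflect θ', e]
    rfl

lemma exists_compat_of_isSymmetric {θ : Param 3} (hθ : θ ∈ Omega 3)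
    (h : IsSymmetric (Delta θ)) : ∃ θ' ∈ Omega 3, Compat θ θ' ∧ θ' ≠ θ := by
  obtain ⟨s, hs⟩ := (isSymmetric_Delta_iff hθ).1 h
  -- A distribution symmetric about `s` is compatible with the point mass at `s`. The weightless
  -- location `a` stays free, so the companion can be made different from `θ`.
  have key : ∀ a < s, (![0, 1, 0], ![a, s, s + 1]) ∈ Omega 3 ∧
      Compat θ (![0, 1, 0], ![a, s, s + 1]) := by
    refine fun a ha => ⟨mem_Omega_three le_rfl zero_le_one le_rfl (by norm_num) ha
      (by linarith), fun t => (Finset.sum_congr rfl fun i _ => ?_).trans (hs t)⟩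
    simp [Fin.sum_univ_three]
  by_cases hne : θ.2 0 = s - 1
  · refine ⟨_, (key (s - 2) (by linarith)).1, (key (s - 2) (by linarith)).2, fun e => ?_⟩
    rw [← e] at hne
    have hne : s - 2 = s - 1 := hne
    linarith
  · refine ⟨_, (key (s - 1) (by linarith)).1, (key (s - 1) (by linarith)).2, fun e => hne ?_⟩
    rw [← e]
    rfl

/-- Moving a location that carries no weight gives a compatible parameter. -/
lemma exists_compat_of_weight_eq_zero {θ : Param 3} (hθ : θ ∈ Omega 3) {j : Fin 3}
    (hj : θ.1 j = 0) : ∃ θ' ∈ Omega 3, Compat θ θ' ∧ θ' ≠ θ := by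
  obtain ⟨ha1, ha2⟩ := three_lt_of_strictMono hθ.2.2
  obtain ⟨y, hy, hmono⟩ : ∃ y, y ≠ θ.2 j ∧ StrictMono (Function.update θ.2 j y) := by
    have hup : ∀ y, (Function.update θ.2 j y) = ![Function.update θ.2 j y 0,
      Function.update θ.2 j y 1, Function.update θ.2 j y 2] := fun y => vec_three_eq _
    fin_cases j
    · refine ⟨θ.2 0 - 1, fun h => by simp at h, ?_⟩
      rw [hup]
      exact strictMono_three (by simp; linarith) (by simpa using ha2)
    · refine ⟨(θ.2 0 + θ.2 1) / 2, fun h => by simp at h; linarith, ?_⟩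
      rw [hup]
      exact strictMono_three (by simp; linarith) (by simp; linarith)
    · refine ⟨θ.2 2 + 1, fun h => by simp at h, ?_⟩
      rw [hup]
      exact strictMono_three (by simpa using ha1) (by simp; linarith)
  have hΩ : (θ.1, Function.update θ.2 j y) ∈ Omega 3 := ⟨hθ.1, hθ.2.1, hmono⟩
  refine ⟨_, hΩ, compat_of_Delta_eq hθ hΩ ?_, fun e => hy ?_⟩
  · refine Finset.sum_congr rfl fun i _ => ?_
    by_cases hij : i = j
    · subst hij
      simp [hj]
    · simp [Function.update_of_ne hij]
  · have := congrFun (congrArg Prod.snd e) j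
    simpa using this

end SymMixture

theorem theoremA1 :
    SymMixture.OmegaStar 3 =
      SymMixture.Omega 3 \ (SymMixture.setA ∪ SymMixture.setAneg ∪ SymMixture.setB) := by
  open SymMixture in
  ext θ
  rw [mem_OmegaStar_iff, Set.mem_sdiff]
  refine and_congr_right fun hθ => ⟨fun h hmem => ?_, fun hmem θ' hθ' hc => ?_⟩
  · have hex : ∃ θ' ∈ Omega 3, Compat θ θ' ∧ θ' ≠ θ := by
      rcases hmem with (hA | hA) | ⟨-, hB | hB⟩
      · exact exists_compat_of_mem_setA hA
      · exact exists_compat_of_mem_setAneg hA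
      · exact exists_compat_of_isSymmetric hθ hB
      · rcases mul_eq_zero.1 hB with hB | hB
        · rcases mul_eq_zero.1 hB with hB | hB <;>
            exact exists_compat_of_weight_eq_zero hθ hB
        · exact exists_compat_of_weight_eq_zero hθ hB
    obtain ⟨θ', hθ', hc, hne⟩ := hex
    exact hne (h θ' hθ' hc)
  · have hpos : ∀ i, 0 < θ.1 i := by
      refine fun i => (hθ.1 i).lt_of_ne fun h0 => hmem (.inr ⟨hθ, .inr ?_⟩)
      rw [← Fin.prod_univ_three]
      exact Finset.prod_eq_zero (Finset.mem_univ i) h0.symm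
    exact (hc.eq_or_mem hθ hpos hθ').resolve_left hmem

end
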